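/- Let $n\ge 1$. For $\alpha>0$ let $$\Phi_\alpha(x,t)=\frac{t^{\alpha-1}}{\Gamma(\alpha)}\,\frac{e^{-|x|^2/(4t)}}{(4\pi t)^{n/2}}\ \text{ for } t>0,\qquad \Phi_\alpha(x,t)=0\ \text{ for } t\le 0,\qquad (x,t)\in\mathbb R^n\times\mathbb R,$$ $$J_\alpha f(x,t)=\iint_{\mathbb R^n\times(-\infty,t)}\Phi_\alpha(x-\xi,t-\tau)f(\xi,\tau)\,d\xi\,d\tau .$$ For $p\in[1,\infty)$ let $X^p=\bigcap_{T\in\mathbb R}L^p(\mathbb R^n\times(-\infty,T))$ and $Y^p_\alpha=J_\alpha(X^p)$. If either $p>1$ and $0<\alpha<\frac{n+2}{2p}$, or $p=1$ and $0<\alpha\le\frac{n+2}{2p}$, the fractional heat operator $(\partial_t-\Delta)^\alpha:Y^p_\alpha\to X^p$ is the inverse of $J_\alpha:X^p\to Y^p_\alpha$; that is, $(\partial_t-\Delta)^\alpha u=f$ means $f\in X^p$ and $u=J_\alpha f$. Functions equal almost everywhere are identified, and equalities and inequalities between functions hold almost everywhere. **Theorem 2.5.** Let $p,q\in[1,\infty)$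 and $\lambda,\sigma,\alpha,\beta\in(0,\infty)$. Suppose that ($p>1$ and $\alpha<\frac{n+2}{2p}$) or ($p=1$ and $\alpha\le\frac{n+2}{2p}$), that ($q>1$ and $\beta<\frac{n+2}{2q}$) or ($q=1$ and $\beta\le\frac{n+2}{2q}$), and that $$(n+2-2p\alpha)q^2\sigma\le(n+2-2q\beta)p^2\lambda,\qquad 2p\alpha<n+2,$$ $$\sigma>\mu(\lambda):=\frac{2p\beta}{n+2-2p\alpha}+\frac{n+2}{(n+2-2p\alpha)\lambda}.$$ Let $r\in(p,\infty]$ and $s\in(s_0,\infty]$, where $$s_0=\max\{q,\,q\sigma_0/\sigma\},\qquad \sigma_0=\frac{(n+2)p}{(n+2-2p\alpha)q}.$$ Then there exist nonnegative functions $u\in Y^p_\alpha$ and $v\in Y^q_\beta$ with $$0\le(\partial_t-\Delta)^\alpha u\le v^\lambda,\qquad 0\le(\partial_t-\Delta)^\beta v\le u^\sigma\qquad\text{in }\mathbb R^n\times\mathbb R,$$ $$u=v=0\qquad\text{in }\mathbb R^n\times(-\infty,0),$$ and a sequence $\{t_j\}\subset(0,1)$ with $\lim_{j\to\infty}t_j=0$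 such that, for every $j$, $$\|v^\lambda\|_{L^r(R_j)}=\|(\partial_t-\Delta)^\alpha u\|_{L^r(R_j)}=\infty,\qquad \|u^\sigma\|_{L^s(R_j)}=\|(\partial_t-\Delta)^\beta v\|_{L^s(R_j)}=\infty,$$ where $R_j=\{(x,t)\in\mathbb R^n\times\mathbb R:\ |x|<\sqrt{t_j}\ \text{and}\ t_j<t<2t_j\}$. -/

import Mathlib

open MeasureTheory Set Filter Topology
open scoped ENNReal

/-- Space-time `ℝⁿ × ℝ` with the Euclidean norm on `ℝⁿ` and Lebesgue measure. -/
abbrev SpaceTime (n : ℕ) : Type := EuclideanSpace ℝ (Fin n) × ℝ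

/-- The fractional heat kernel `Φ_α(x,t)`, which vanishes for `t ≤ 0`. -/
noncomputable def fracHeatKernel (n : ℕ) (α : ℝ) (x : EuclideanSpace ℝ (Fin n)) (t : ℝ) : ℝ :=
  if 0 < t then
    t ^ (α - 1) / Real.Gamma α * (1 / (4 * Real.pi * t) ^ ((n : ℝ) / 2)) *
      Real.exp (-‖x‖ ^ 2 / (4 * t))
  else 0

/-- `J_α f(x,t) = ∬_{ℝⁿ × (-∞,t)} Φ_α(x - ξ, t - τ) f(ξ,τ) dξ dτ`. -/
noncomputable def fracHeatPotential (n : ℕ) (α : ℝ) (f : SpaceTime n → ℝ) (z : SpaceTime n) : ℝ :=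
  ∫ w in {w : SpaceTime n | w.2 < z.2}, fracHeatKernel n α (z.1 - w.1) (z.2 - w.2) * f w

/-- `f ∈ X^p`, the intersection over all `T ∈ ℝ` of the spaces `L^p(ℝⁿ × (-∞,T))`. -/
def MemX (n : ℕ) (p : ℝ) (f : SpaceTime n → ℝ) : Prop :=
  ∀ T : ℝ, MemLp f (ENNReal.ofReal p) (volume.restrict {z : SpaceTime n | z.2 < T})

/-- `u = J_α f` almost everywhere, the integral defining `J_α f` being absolutely convergent
almost everywhere. -/
def EqPotential (n : ℕ) (α : ℝ) (f u : SpaceTime n → ℝ) : Prop :=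
  ∀ᵐ z : SpaceTime n,
    IntegrableOn (fun w : SpaceTime n => fracHeatKernel n α (z.1 - w.1) (z.2 - w.2) * f w)
      {w : SpaceTime n | w.2 < z.2} ∧
    u z = fracHeatPotential n α f z

/-- `u ∈ Y^p_α := J_α(X^p)`; functions that agree almost everywhere are identified. -/
def MemY (n : ℕ) (p α : ℝ) (u : SpaceTime n → ℝ) : Prop :=
  ∃ f : SpaceTime n → ℝ, MemX n p f ∧ EqPotential n α f u

/-- `(∂_t - Δ)^α u = f`. The operator `(∂_t - Δ)^α : Y^p_α → X^p` is the inverse of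
`J_α : X^p → Y^p_α`, so this is the relation `f ∈ X^p` and `u = J_α f`. -/
def IsFracHeat (n : ℕ) (p α : ℝ) (u f : SpaceTime n → ℝ) : Prop :=
  MemX n p f ∧ EqPotential n α f u

/-- The range of `p` and `α` for which `(∂_t - Δ)^α : Y^p_α → X^p` is defined. -/
def FracHeatAdmissible (n : ℕ) (p α : ℝ) : Prop :=
  (1 < p ∧ 0 < α ∧ α < ((n : ℝ) + 2) / (2 * p)) ∨
    (p = 1 ∧ 0 < α ∧ α ≤ ((n : ℝ) + 2) / (2 * p))

/-- `μ(λ) = 2pβ / (n+2-2pα) + (n+2) / ((n+2-2pα) λ)`. -/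
noncomputable def muCurve (n : ℕ) (p α β lam : ℝ) : ℝ :=
  2 * p * β / ((n : ℝ) + 2 - 2 * p * α) +
    ((n : ℝ) + 2) / (((n : ℝ) + 2 - 2 * p * α) * lam)

/-- `σ₀ = (n+2)p / ((n+2-2pα)q)`. -/
noncomputable def sigmaZero (n : ℕ) (p q α : ℝ) : ℝ :=
  ((n : ℝ) + 2) * p / (((n : ℝ) + 2 - 2 * p * α) * q)

/-- `{(x,t) : |x| < √τ and τ < t < 2τ}`. -/
def parabolicRegion (n : ℕ) (τ : ℝ) : Set (SpaceTime n) :=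
  {z | ‖z.1‖ < Real.sqrt τ ∧ τ < z.2 ∧ z.2 < 2 * τ}

/-! Both right-hand sides are prescribed: `f` and `g` are the powers `-a` and `-b` of the elapsed
time `s`, supported on thin, pairwise disjoint forward paraboloids whose apexes tend to the origin;
`u` and `v` are their potentials. A time slice has volume of order `s^(n/2)`, so with `M = (n+2)/2`
the power `-a` is `p`-integrable exactly when `a * p < M` (`memLp_paraboloidPower`,
`eLpNorm_paraboloidPower_eq_top`).

By parabolic scaling the potential gains `α` powers: `J_α f ≥ c * s^(α - a)` on each paraboloid
(`exists_fracHeatPotential_lower_bound`). If `b < σ * (a - α)` and `a < lam * (b - β)`, the spare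
power of `s` absorbs the constants once the paraboloids are thin, giving `g ≤ u^σ` and `f ≤ v^lam`.
Exponents meeting these gaps, in `L^p` and `L^q` but not in `L^r` and `L^s`, exist by
`exists_singular_exponents`. -/

/-! ### Powers on paraboloids and their Lebesgue norms. -/

/-- The times `2^{-(j+1)}` at which the singularities are placed. -/
noncomputable def apexTime (j : ℕ) : ℝ := (1 / 2) ^ (j + 1)

lemma apexTime_pos (j : ℕ) : 0 < apexTime j := by unfold apexTime; positivity

lemma apexTime_lt_one (j : ℕ) : apexTime j < 1 :=
  pow_lt_one₀ (by norm_num) (by norm_num) (by omega)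

lemma two_mul_apexTime_le {i j : ℕ} (h : i < j) : 2 * apexTime j ≤ apexTime i := by
  have h1 : apexTime j ≤ apexTime (i + 1) :=
    pow_le_pow_of_le_one (by norm_num) (by norm_num) (by omega)
  have h2 : 2 * apexTime (i + 1) = apexTime i := by
    unfold apexTime; rw [pow_succ (1 / 2 : ℝ) (i + 1)]; ring
  linarith

lemma tendsto_apexTime : Tendsto apexTime atTop (𝓝 0) :=
  (tendsto_add_atTop_iff_nat 1).2
    (tendsto_pow_atTop_nhds_zero_of_lt_one (by norm_num) (by norm_num))

/-- A forward paraboloid with apex `(0, apexTime j)` and height `ε * apexTime j`. -/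
def paraboloid (n : ℕ) (ε : ℝ) (j : ℕ) : Set (SpaceTime n) :=
  {z | 0 < z.2 - apexTime j ∧ z.2 - apexTime j < ε * apexTime j ∧
    ‖z.1‖ < Real.sqrt (z.2 - apexTime j)}

/-- The function equal to `(t - apexTime j) ^ (-a)` on the `j`-th paraboloid and to zero
elsewhere. -/
noncomputable def paraboloidPower (n : ℕ) (ε a : ℝ) (z : SpaceTime n) : ℝ≥0∞ :=
  ∑' j, (paraboloid n ε j).indicator
    (fun w => ENNReal.ofReal ((w.2 - apexTime j) ^ (-a))) z

section

variable {n : ℕ} {ε : ℝ}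

lemma measurableSet_paraboloid (j : ℕ) : MeasurableSet (paraboloid n ε j) := by
  have h1 : Measurable fun z : SpaceTime n => z.2 - apexTime j := by fun_prop
  exact (measurableSet_lt measurable_const h1).inter ((measurableSet_lt h1 measurable_const).inter
    (measurableSet_lt measurable_fst.norm h1.sqrt))

lemma paraboloid_subset_parabolicRegion (hε : ε ≤ 1) (j : ℕ) :
    paraboloid n ε j ⊆ parabolicRegion n (apexTime j) := by
  rintro z ⟨h1, h2, h3⟩
  have hj := apexTime_pos j
  have h4 : z.2 - apexTime j < apexTime j := h2.trans_le (by nlinarith)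
  exact ⟨h3.trans_le (Real.sqrt_le_sqrt h4.le), by linarith, by linarith⟩

/-- The time intervals `(t_j, 2 t_j)` are disjoint because the apex times halve. -/
lemma paraboloid_index_unique (hε : ε ≤ 1) {i j : ℕ} {z : SpaceTime n}
    (hi : z ∈ paraboloid n ε i) (hj : z ∈ paraboloid n ε j) : i = j := by
  obtain ⟨-, hi1, hi2⟩ := paraboloid_subset_parabolicRegion hε i hi
  obtain ⟨-, hj1, hj2⟩ := paraboloid_subset_parabolicRegion hε j hj
  rcases lt_trichotomy i j with h | h | h
  · linarith [two_mul_apexTime_le h]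
  · exact h
  · linarith [two_mul_apexTime_le h]

lemma paraboloidPower_of_mem (hε : ε ≤ 1) (a : ℝ) {j : ℕ} {z : SpaceTime n}
    (hz : z ∈ paraboloid n ε j) :
    paraboloidPower n ε a z = ENNReal.ofReal ((z.2 - apexTime j) ^ (-a)) := by
  unfold paraboloidPower
  rw [tsum_eq_single j, indicator_of_mem hz]
  intro i hij
  exact indicator_of_notMem (fun hi => hij (paraboloid_index_unique hε hi hz)) _

lemma paraboloidPower_of_notMem (a : ℝ) {z : SpaceTime n} (hz : ∀ j, z ∉ paraboloid n ε j) :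
    paraboloidPower n ε a z = 0 := by
  simp [paraboloidPower, hz]

lemma measurable_paraboloidPower (a : ℝ) : Measurable (paraboloidPower n ε a) := by
  refine Measurable.tsum fun j => Measurable.indicator ?_ (measurableSet_paraboloid j)
  fun_prop

lemma paraboloidPower_ne_top (hε : ε ≤ 1) (a : ℝ) (z : SpaceTime n) :
    paraboloidPower n ε a z ≠ ∞ := by
  by_cases h : ∃ j, z ∈ paraboloid n ε j
  · obtain ⟨j, hj⟩ := h
    simp [paraboloidPower_of_mem hε a hj]
  · push Not at h
    simp [paraboloidPower_of_notMem a h]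

lemma paraboloidPower_rpow (hε : ε ≤ 1) (a : ℝ) {p : ℝ} (hp : 0 < p) (z : SpaceTime n) :
    paraboloidPower n ε a z ^ p = paraboloidPower n ε (a * p) z := by
  by_cases h : ∃ j, z ∈ paraboloid n ε j
  · obtain ⟨j, hj⟩ := h
    rw [paraboloidPower_of_mem hε _ hj, paraboloidPower_of_mem hε _ hj,
      ENNReal.ofReal_rpow_of_nonneg (Real.rpow_nonneg hj.1.le _) hp.le,
      ← Real.rpow_mul hj.1.le, neg_mul]
  · push Not at h
    simp [paraboloidPower_of_notMem _ h, hp]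

/-- The slice at elapsed time `s` is a ball of radius `√s`, contributing the factor `s^(n/2)`. -/
lemma lintegral_paraboloid (a : ℝ) (j : ℕ) :
    ∫⁻ z in paraboloid n ε j, ENNReal.ofReal ((z.2 - apexTime j) ^ (-a)) =
      volume (Metric.ball (0 : EuclideanSpace ℝ (Fin n)) 1) *
        ∫⁻ s in Ioo 0 (ε * apexTime j), ENNReal.ofReal (s ^ ((n : ℝ) / 2 - a)) := by
  rw [← lintegral_indicator (measurableSet_paraboloid j), Measure.volume_eq_prod,
    lintegral_prod_symm' _ (Measurable.indicator (by fun_prop) (measurableSet_paraboloid j)),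
    ← lintegral_const_mul _ (by fun_prop), ← lintegral_indicator measurableSet_Ioo,
    ← lintegral_sub_right_eq_self
      ((Ioo 0 (ε * apexTime j)).indicator _) (apexTime j)]
  refine lintegral_congr fun t => ?_
  by_cases ht : t - apexTime j ∈ Ioo 0 (ε * apexTime j)
  · rw [indicator_of_mem ht]
    have h1 : ∀ x : EuclideanSpace ℝ (Fin n),
        (paraboloid n ε j).indicator
          (fun z : SpaceTime n => ENNReal.ofReal ((z.2 - apexTime j) ^ (-a))) (x, t) =
        (Metric.ball (0 : EuclideanSpace ℝ (Fin n)) (Real.sqrt (t - apexTime j))).indicator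
          (fun _ => ENNReal.ofReal ((t - apexTime j) ^ (-a))) x := by
      intro x
      simp only [indicator, paraboloid, mem_ofPred_eq, mem_ball_zero_iff]
      simp [ht.1, ht.2, -sub_pos]
    simp_rw [h1]
    rw [lintegral_indicator_const Metric.isOpen_ball.measurableSet,
      Measure.addHaar_ball_of_pos _ _ (Real.sqrt_pos.2 ht.1), finrank_euclideanSpace_fin,
      ← mul_assoc, ← ENNReal.ofReal_mul (Real.rpow_nonneg ht.1.le _), mul_comm]
    congr 2
    rw [Real.sqrt_eq_rpow, ← Real.rpow_natCast, ← Real.rpow_mul ht.1.le, ← Real.rpow_add ht.1]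
    congr 1
    ring
  · rw [indicator_of_notMem ht, ← lintegral_zero]
    refine lintegral_congr fun x => indicator_of_notMem (fun h => ht ⟨h.1, h.2.1⟩) _

lemma lintegral_Ioo_rpow_eq_top {c ρ : ℝ} (hc : c ≤ -1) (hρ : 0 < ρ) :
    ∫⁻ s in Ioo 0 ρ, ENNReal.ofReal (s ^ c) = ∞ := by
  by_contra h
  have h1 : IntegrableOn (fun s : ℝ => s ^ c) (Ioo 0 ρ) := by
    refine ⟨by fun_prop, ?_⟩
    rw [hasFiniteIntegral_iff_ofReal]
    · exact lt_top_iff_ne_top.2 h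
    · filter_upwards [self_mem_ae_restrict measurableSet_Ioo] with s hs
      exact Real.rpow_nonneg hs.1.le _
  rw [intervalIntegral.integrableOn_Ioo_rpow_iff hρ] at h1
  linarith

lemma lintegral_Ioo_rpow {c ρ : ℝ} (hc : -1 < c) (hρ : 0 < ρ) :
    ∫⁻ s in Ioo 0 ρ, ENNReal.ofReal (s ^ c) = ENNReal.ofReal (ρ ^ (c + 1) / (c + 1)) := by
  rw [← ofReal_integral_eq_lintegral_ofReal
    ((intervalIntegral.integrableOn_Ioo_rpow_iff hρ).2 hc)]
  · rw [← integral_Ioc_eq_integral_Ioo, ← intervalIntegral.integral_of_le hρ.le,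
      integral_rpow (Or.inl hc), Real.zero_rpow (by linarith), sub_zero]
  · filter_upwards [self_mem_ae_restrict measurableSet_Ioo] with s hs
    exact Real.rpow_nonneg hs.1.le _

/-- Heights are proportional to `apexTime j`, so the integrals over single paraboloids form a
geometric series of ratio `(1/2)^((n+2)/2 - a)`. -/
lemma lintegral_paraboloidPower_lt_top (hε : 0 < ε) {a : ℝ} (ha : a < ((n : ℝ) + 2) / 2) :
    ∫⁻ z, paraboloidPower n ε a z < ∞ := by
  unfold paraboloidPower
  have hc : -1 < (n : ℝ) / 2 - a := by linarith
  set c := (n : ℝ) / 2 - a with hcdef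
  have hc1 : 0 < c + 1 := by linarith
  rw [lintegral_tsum fun j =>
    (Measurable.indicator (by fun_prop) (measurableSet_paraboloid j)).aemeasurable]
  have h1 : ∀ j, ∫⁻ z, (paraboloid n ε j).indicator
      (fun w => ENNReal.ofReal ((w.2 - apexTime j) ^ (-a))) z =
      volume (Metric.ball (0 : EuclideanSpace ℝ (Fin n)) 1) *
        (ENNReal.ofReal (ε ^ (c + 1) * (1 / 2) ^ (c + 1) / (c + 1)) *
          ENNReal.ofReal ((1 / 2) ^ (c + 1)) ^ j) := by
    intro j
    rw [lintegral_indicator (measurableSet_paraboloid j), lintegral_paraboloid, ← hcdef,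
      lintegral_Ioo_rpow hc (mul_pos hε (apexTime_pos j)),
      ← ENNReal.ofReal_pow (by positivity), ← ENNReal.ofReal_mul (by positivity)]
    congr 2
    rw [Real.mul_rpow hε.le (apexTime_pos j).le, apexTime, ← Real.rpow_natCast,
      ← Real.rpow_natCast, ← Real.rpow_mul (by norm_num), ← Real.rpow_mul (by norm_num),
      mul_div_right_comm, mul_div_right_comm, mul_assoc,
      ← Real.rpow_add (by norm_num)]
    congr 2
    push_cast
    ring
  simp_rw [h1]
  rw [ENNReal.tsum_mul_left, ENNReal.tsum_mul_left, ENNReal.tsum_geometric]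
  refine ENNReal.mul_lt_top measure_ball_lt_top (ENNReal.mul_lt_top ENNReal.ofReal_lt_top ?_)
  rw [ENNReal.inv_lt_top, tsub_pos_iff_lt, ← ENNReal.ofReal_one,
    ENNReal.ofReal_lt_ofReal_iff one_pos]
  exact Real.rpow_lt_one (by norm_num) (by norm_num) hc1

lemma enorm_toReal_paraboloidPower (hε : ε ≤ 1) (a : ℝ) (z : SpaceTime n) :
    ‖(paraboloidPower n ε a z).toReal‖ₑ = paraboloidPower n ε a z := by
  rw [Real.enorm_eq_ofReal ENNReal.toReal_nonneg,
    ENNReal.ofReal_toReal (paraboloidPower_ne_top hε a z)]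

lemma memLp_paraboloidPower (hε : 0 < ε) (hε1 : ε ≤ 1) {a p : ℝ} (hp : 0 < p)
    (ha : a * p < ((n : ℝ) + 2) / 2) :
    MemLp (fun z => (paraboloidPower n ε a z).toReal) (ENNReal.ofReal p) := by
  refine ⟨(measurable_paraboloidPower a).ennreal_toReal.aestronglyMeasurable, ?_⟩
  rw [eLpNorm_lt_top_iff_lintegral_rpow_enorm_lt_top (by simpa using hp) ENNReal.ofReal_ne_top]
  simp_rw [enorm_toReal_paraboloidPower hε1, ENNReal.toReal_ofReal hp.le,
    paraboloidPower_rpow hε1 a hp]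
  exact lintegral_paraboloidPower_lt_top hε ha

lemma volume_parabolicRegion_lt_top (τ : ℝ) : volume (parabolicRegion n τ) < ∞ := by
  refine lt_of_le_of_lt (measure_mono (t := Metric.ball (0 : EuclideanSpace ℝ (Fin n))
    (Real.sqrt τ) ×ˢ Ioo τ (2 * τ)) fun z hz => ⟨by simpa using hz.1, hz.2⟩) ?_
  rw [Measure.volume_eq_prod, Measure.prod_prod]
  exact ENNReal.mul_lt_top measure_ball_lt_top (by simp)

/-- The region has finite measure, so a finite `L^r` norm, even for `r = ∞`, would force a finite
`L^{r'}` norm; the integral over one paraboloid already diverges. -/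
lemma eLpNorm_paraboloidPower_eq_top (hε : 0 < ε) (hε1 : ε ≤ 1) {a r' : ℝ} (hr' : 0 < r')
    (ha : ((n : ℝ) + 2) / 2 ≤ a * r') {r : ℝ≥0∞} (hr : ENNReal.ofReal r' ≤ r) (j : ℕ) :
    eLpNorm (fun z => (paraboloidPower n ε a z).toReal) r
      (volume.restrict (parabolicRegion n (apexTime j))) = ∞ := by
  by_contra h
  have : IsFiniteMeasure (volume.restrict (parabolicRegion n (apexTime j))) :=
    ⟨by simpa using volume_parabolicRegion_lt_top _⟩
  have h1 : MemLp (fun z => (paraboloidPower n ε a z).toReal) r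
      (volume.restrict (parabolicRegion n (apexTime j))) :=
    ⟨(measurable_paraboloidPower a).ennreal_toReal.aestronglyMeasurable,
      lt_top_iff_ne_top.2 h⟩
  have h2 := (h1.mono_exponent hr).2
  rw [eLpNorm_lt_top_iff_lintegral_rpow_enorm_lt_top (by simpa using hr')
    ENNReal.ofReal_ne_top] at h2
  simp_rw [enorm_toReal_paraboloidPower hε1, ENNReal.toReal_ofReal hr'.le,
    paraboloidPower_rpow hε1 a hr'] at h2
  have h3 := (lintegral_mono_set (μ := volume) (f := paraboloidPower n ε (a * r'))
    (paraboloid_subset_parabolicRegion hε1 j)).trans_lt h2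
  rw [setLIntegral_congr_fun (measurableSet_paraboloid j)
    (fun z hz => paraboloidPower_of_mem hε1 _ hz), lintegral_paraboloid,
    lintegral_Ioo_rpow_eq_top (by linarith) (mul_pos hε (apexTime_pos j)),
    ENNReal.mul_top (Metric.measure_ball_pos _ _ one_pos).ne'] at h3
  exact lt_irrefl _ h3

lemma paraboloidPower_of_nonpos (a : ℝ) {z : SpaceTime n} (hz : z.2 ≤ 0) :
    paraboloidPower n ε a z = 0 :=
  paraboloidPower_of_notMem a fun j hj => by linarith [hj.1, apexTime_pos j]

end

/-! ### The heat kernel and lower bounds for its potentials. -/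

section

variable {n : ℕ} {α : ℝ}

lemma fracHeatKernel_nonneg (hα : 0 < α) (x : EuclideanSpace ℝ (Fin n)) (t : ℝ) :
    0 ≤ fracHeatKernel n α x t := by
  unfold fracHeatKernel
  have := Real.Gamma_pos_of_pos hα
  split_ifs <;> positivity

lemma measurable_fracHeatKernel :
    Measurable fun z : SpaceTime n => fracHeatKernel n α z.1 z.2 := by
  unfold fracHeatKernel
  refine Measurable.ite (measurableSet_lt measurable_const measurable_snd) ?_ measurable_const
  fun_prop

/-- A non-integrable function has Bochner integral zero, whereas the Gaussian integral is positive.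
-/
lemma integrable_exp_neg_mul_sq_norm {b : ℝ} (hb : 0 < b) :
    Integrable fun x : EuclideanSpace ℝ (Fin n) => Real.exp (-b * ‖x‖ ^ 2) := by
  by_contra h
  have h1 := GaussianFourier.integral_rexp_neg_mul_sq_norm (V := EuclideanSpace ℝ (Fin n)) hb
  rw [integral_undef h] at h1
  have : 0 < (Real.pi / b) ^ (Module.finrank ℝ (EuclideanSpace ℝ (Fin n)) / 2 : ℝ) := by
    have := Real.pi_pos
    positivity
  exact this.ne h1

lemma integrable_fracHeatKernel_left (t : ℝ) :
    Integrable fun x : EuclideanSpace ℝ (Fin n) => fracHeatKernel n α x t := by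
  unfold fracHeatKernel
  by_cases ht : 0 < t
  · simp only [ht, if_true]
    refine Integrable.const_mul ?_ _
    convert integrable_exp_neg_mul_sq_norm (n := n) (b := 1 / (4 * t)) (by positivity) using 3
    ring
  · simp [ht]

lemma integral_fracHeatKernel {t : ℝ} (ht : 0 < t) :
    ∫ x : EuclideanSpace ℝ (Fin n), fracHeatKernel n α x t = t ^ (α - 1) / Real.Gamma α := by
  unfold fracHeatKernel
  simp only [ht, if_true]
  rw [integral_const_mul]
  have h1 := GaussianFourier.integral_rexp_neg_mul_sq_norm (V := EuclideanSpace ℝ (Fin n))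
    (b := 1 / (4 * t)) (by positivity)
  have h2 : ∀ x : EuclideanSpace ℝ (Fin n),
      Real.exp (-‖x‖ ^ 2 / (4 * t)) = Real.exp (-(1 / (4 * t)) * ‖x‖ ^ 2) := by
    intro x; congr 1; ring
  simp_rw [h2]
  rw [h1, finrank_euclideanSpace_fin, mul_assoc]
  have h3 : Real.pi / (1 / (4 * t)) = 4 * Real.pi * t := by field_simp
  have h4 : 0 < (4 * Real.pi * t) ^ ((n : ℝ) / 2) := by
    have := Real.pi_pos
    positivity
  rw [h3, one_div, inv_mul_cancel₀ h4.ne', mul_one]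

/-- The spatial mass `t^(α-1) / Γ(α)` is integrable near zero but not at infinity, hence the
truncation in time. -/
lemma integrable_truncated_fracHeatKernel (hα : 0 < α) {T : ℝ} (hT : 0 < T) :
    Integrable ({z : SpaceTime n | z.2 < T}.indicator
      fun z => fracHeatKernel n α z.1 z.2) := by
  have hm : MeasurableSet {z : SpaceTime n | z.2 < T} :=
    measurableSet_lt measurable_snd measurable_const
  rw [Measure.volume_eq_prod,
    integrable_prod_iff' (measurable_fracHeatKernel.indicator hm).aestronglyMeasurable]
  constructor
  · refine Eventually.of_forall fun t => ?_
    by_cases ht : t < T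
    · simpa [indicator, ht] using integrable_fracHeatKernel_left t
    · simp [indicator, ht]
  · have h1 : (fun t => ∫ x : EuclideanSpace ℝ (Fin n),
        ‖{z : SpaceTime n | z.2 < T}.indicator
          (fun z => fracHeatKernel n α z.1 z.2) (x, t)‖) =
        (Ioo 0 T).indicator fun t => t ^ (α - 1) / Real.Gamma α := by
      funext t
      by_cases ht : t ∈ Ioo 0 T
      · rw [indicator_of_mem ht, ← integral_fracHeatKernel (n := n) ht.1]
        refine integral_congr_ae (Eventually.of_forall fun x => ?_)
        simp [indicator, ht.2, abs_of_nonneg (fracHeatKernel_nonneg hα x t)]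
      · rw [indicator_of_notMem ht, ← integral_zero (EuclideanSpace ℝ (Fin n)) ℝ]
        refine integral_congr_ae (Eventually.of_forall fun x => ?_)
        by_cases h0 : 0 < t
        · have hT' : ¬ t < T := fun h => ht ⟨h0, h⟩
          simp [indicator, hT']
        · simp [indicator, fracHeatKernel, h0]
    rw [h1, integrable_indicator_iff measurableSet_Ioo]
    exact ((intervalIntegral.integrableOn_Ioo_rpow_iff hT).2 (by linarith)).div_const _

/-- The potential of an integrable function vanishing for `t ≤ 0` converges absolutely almost
everywhere. -/
lemma ae_integrable_fracHeatKernel_mul (hα : 0 < α) {f : SpaceTime n → ℝ} (hf : Integrable f)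
    (hf0 : ∀ z : SpaceTime n, z.2 ≤ 0 → f z = 0) :
    ∀ᵐ z : SpaceTime n,
      Integrable fun w : SpaceTime n => fracHeatKernel n α (z.1 - w.1) (z.2 - w.2) * f w := by
  have h1 : ∀ k : ℕ, ∀ᵐ z : SpaceTime n, z.2 < (k : ℝ) + 1 →
      Integrable fun w : SpaceTime n => fracHeatKernel n α (z.1 - w.1) (z.2 - w.2) * f w := by
    intro k
    have : (volume : Measure (SpaceTime n)).IsAddHaarMeasure :=
      Measure.prod.instIsAddHaarMeasure _ _
    have h2 := Integrable.ae_convolution_exists (μ := (volume : Measure (SpaceTime n)))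
      (ContinuousLinearMap.mul ℝ ℝ) hf
      (integrable_truncated_fracHeatKernel (n := n) hα (T := (k : ℝ) + 1) (by positivity))
    filter_upwards [h2] with z hz hzk
    refine Integrable.congr hz (Eventually.of_forall fun w => ?_)
    -- Where `f` can be nonzero, `z.2 - w.2 < z.2 < k + 1`, so the truncation is invisible.
    by_cases hw : w.2 ≤ 0
    · simp [hf0 w hw]
    · have h3 : z - w ∈ {z : SpaceTime n | z.2 < (k : ℝ) + 1} := by
        simp only [mem_ofPred_eq, Prod.snd_sub]
        linarith
      simp only [ContinuousLinearMap.mul_apply', indicator_of_mem h3, Prod.fst_sub,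
        Prod.snd_sub]
      ring
  filter_upwards [ae_all_iff.2 h1] with z hz
  obtain ⟨k, hk⟩ := exists_nat_gt z.2
  exact hz k (by linarith)

lemma eqPotential_fracHeatPotential (hα : 0 < α) {f : SpaceTime n → ℝ} (hf : Integrable f)
    (hf0 : ∀ z : SpaceTime n, z.2 ≤ 0 → f z = 0) :
    EqPotential n α f (fracHeatPotential n α f) := by
  filter_upwards [ae_integrable_fracHeatKernel_mul hα hf hf0] with z hz
  exact ⟨hz.integrableOn, rfl⟩

lemma fracHeatPotential_nonneg (hα : 0 < α) {f : SpaceTime n → ℝ} (hf : ∀ z, 0 ≤ f z)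
    (z : SpaceTime n) : 0 ≤ fracHeatPotential n α f z :=
  integral_nonneg fun w => mul_nonneg (fracHeatKernel_nonneg hα _ _) (hf w)

lemma fracHeatPotential_of_nonpos {f : SpaceTime n → ℝ}
    (hf0 : ∀ z : SpaceTime n, z.2 ≤ 0 → f z = 0) {z : SpaceTime n} (hz : z.2 ≤ 0) :
    fracHeatPotential n α f z = 0 := by
  refine setIntegral_eq_zero_of_forall_eq_zero fun w hw => ?_
  rw [hf0 w (le_of_lt (lt_of_lt_of_le hw hz)), mul_zero]

/-- At parabolic scale `s` the kernel is of order `s^(α-1-n/2)`. The minimum covers both signs of `α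
- 1`; the exponent `-2` comes from `‖x‖² ≤ 4s` and `4t ≥ 2s`. -/
lemma fracHeatKernel_lower_bound (hα : 0 < α) {s t : ℝ} (hs : 0 < s) (ht : s / 2 ≤ t)
    (hts : t ≤ s) {x : EuclideanSpace ℝ (Fin n)} (hx : ‖x‖ ≤ 2 * Real.sqrt s) :
    min ((1 / 2) ^ (α - 1)) 1 / Real.Gamma α * (1 / (4 * Real.pi) ^ ((n : ℝ) / 2)) *
      Real.exp (-2) * s ^ (α - 1 - (n : ℝ) / 2) ≤ fracHeatKernel n α x t := by
  have ht0 : 0 < t := by linarith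
  have hπ := Real.pi_pos
  have hΓ := Real.Gamma_pos_of_pos hα
  have h1 : min ((1 / 2) ^ (α - 1)) 1 * s ^ (α - 1) ≤ t ^ (α - 1) := by
    rcases le_total 1 α with h | h
    · calc min ((1 / 2) ^ (α - 1)) 1 * s ^ (α - 1) ≤ (1 / 2) ^ (α - 1) * s ^ (α - 1) := by
            gcongr; exact min_le_left _ _
        _ = (s / 2) ^ (α - 1) := by
            rw [← Real.mul_rpow (by norm_num) hs.le]; congr 1; ring
        _ ≤ t ^ (α - 1) := Real.rpow_le_rpow (by positivity) ht (by linarith)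
    · calc min ((1 / 2) ^ (α - 1)) 1 * s ^ (α - 1) ≤ 1 * s ^ (α - 1) := by
            gcongr; exact min_le_right _ _
        _ ≤ t ^ (α - 1) := by
            rw [one_mul]; exact Real.rpow_le_rpow_of_nonpos ht0 hts (by linarith)
  have h2 : Real.exp (-2) ≤ Real.exp (-‖x‖ ^ 2 / (4 * t)) := by
    rw [Real.exp_le_exp, le_div_iff₀ (by positivity)]
    have : ‖x‖ ^ 2 ≤ 4 * s := by
      calc ‖x‖ ^ 2 ≤ (2 * Real.sqrt s) ^ 2 := by gcongr
        _ = 4 * s := by rw [mul_pow, Real.sq_sqrt hs.le]; norm_num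
    linarith
  have h3 : 1 / (4 * Real.pi * s) ^ ((n : ℝ) / 2) ≤ 1 / (4 * Real.pi * t) ^ ((n : ℝ) / 2) := by
    gcongr
  have h4 : s ^ (α - 1 - (n : ℝ) / 2) = s ^ (α - 1) * (s ^ ((n : ℝ) / 2))⁻¹ := by
    rw [Real.rpow_sub hs, div_eq_mul_inv]
  have h5 : (4 * Real.pi * s) ^ ((n : ℝ) / 2) =
      (4 * Real.pi) ^ ((n : ℝ) / 2) * s ^ ((n : ℝ) / 2) :=
    Real.mul_rpow (by positivity) hs.le
  have h6 : 0 ≤ min ((1 / 2 : ℝ) ^ (α - 1)) 1 := by positivity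
  unfold fracHeatKernel
  rw [if_pos ht0]
  calc _ = (min ((1 / 2) ^ (α - 1)) 1 * s ^ (α - 1)) / Real.Gamma α *
        (1 / (4 * Real.pi * s) ^ ((n : ℝ) / 2)) * Real.exp (-2) := by
        rw [h4, h5]; field_simp
    _ ≤ _ := by gcongr

/-- On each paraboloid, the potential of `paraboloidPower n ε a` is at least a multiple of the
power `α - a` of the time elapsed since the apex. -/
lemma exists_fracHeatPotential_lower_bound (n : ℕ) (hα : 0 < α) {a : ℝ} (ha : 0 < a) :
    ∃ c > 0, ∀ ε : ℝ, ε ≤ 1 → ∀ j, ∀ z ∈ paraboloid n ε j,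
      Integrable (fun w : SpaceTime n =>
        fracHeatKernel n α (z.1 - w.1) (z.2 - w.2) * (paraboloidPower n ε a w).toReal) →
      c * (z.2 - apexTime j) ^ (α - a) ≤
        fracHeatPotential n α (fun w => (paraboloidPower n ε a w).toReal) z := by
  set K := min ((1 / 2) ^ (α - 1)) 1 / Real.Gamma α * (1 / (4 * Real.pi) ^ ((n : ℝ) / 2)) *
      Real.exp (-2) with hK
  have hK0 : 0 < K := by
    have hπ := Real.pi_pos
    have hΓ := Real.Gamma_pos_of_pos hα
    positivity
  set ω := volume.real (Metric.ball (0 : EuclideanSpace ℝ (Fin n)) 1) with hω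
  have hω0 : 0 < ω :=
    ENNReal.toReal_pos (Metric.measure_ball_pos _ _ one_pos).ne' measure_ball_lt_top.ne
  -- Kernel constant times the volume of the cylinder `B` below at `s = 1`. It does not depend on
  -- `ε`, which can therefore be chosen afterwards.
  refine ⟨K * ω * (1 / 4) ^ ((n : ℝ) / 2) * (1 / 4), by positivity, ?_⟩
  rintro ε hε j z ⟨hz1, hz2, hz3⟩ hint
  set s := z.2 - apexTime j with hs
  -- `B` lies in the same paraboloid as `z`, with time lags between `s/2` and `s` and spatial
  -- distances at most `2√s`.
  set B : Set (SpaceTime n) := Metric.ball (0 : EuclideanSpace ℝ (Fin n)) (Real.sqrt (s / 4)) ×ˢ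
    Ioo (apexTime j + s / 4) (apexTime j + s / 2) with hB
  have hBm : MeasurableSet B := Metric.isOpen_ball.measurableSet.prod measurableSet_Ioo
  have hBv : volume.real B = (s / 4) ^ ((n : ℝ) / 2) * ω * (s / 4) := by
    rw [hB, Measure.real, Measure.volume_eq_prod, Measure.prod_prod,
      Measure.addHaar_ball_of_pos _ _ (Real.sqrt_pos.2 (by positivity)), Real.volume_Ioo,
      ENNReal.toReal_mul, ENNReal.toReal_mul, ENNReal.toReal_ofReal (by positivity),
      ENNReal.toReal_ofReal (by linarith), finrank_euclideanSpace_fin, Real.sqrt_eq_rpow,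
      ← Real.rpow_natCast, ← Real.rpow_mul (by positivity), hω, Measure.real]
    congr 1
    · congr 2; ring
    · ring
  have hBt : volume B ≠ ∞ := by
    rw [hB, Measure.volume_eq_prod, Measure.prod_prod]
    exact (ENNReal.mul_lt_top measure_ball_lt_top (by simp)).ne
  have hsub : B ⊆ {w : SpaceTime n | w.2 < z.2} := by
    rintro w ⟨-, -, hw⟩
    simp only [mem_ofPred_eq]
    linarith
  have hpt : ∀ w ∈ B, K * s ^ (α - 1 - (n : ℝ) / 2) * s ^ (-a) ≤
      fracHeatKernel n α (z.1 - w.1) (z.2 - w.2) * (paraboloidPower n ε a w).toReal := by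
    rintro w ⟨hw1, hw2, hw3⟩
    rw [mem_ball_zero_iff] at hw1
    have hwmem : w ∈ paraboloid n ε j := by
      refine ⟨by linarith, by linarith, hw1.trans_le (Real.sqrt_le_sqrt (by linarith))⟩
    rw [paraboloidPower_of_mem hε a hwmem,
      ENNReal.toReal_ofReal (Real.rpow_nonneg hwmem.1.le _)]
    have h1 := fracHeatKernel_lower_bound (n := n) hα hz1 (t := z.2 - w.2) (x := z.1 - w.1)
      (by linarith) (by linarith) (by
        have : Real.sqrt (s / 4) ≤ Real.sqrt s := Real.sqrt_le_sqrt (by linarith)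
        linarith [norm_sub_le z.1 w.1])
    have h2 : s ^ (-a) ≤ (w.2 - apexTime j) ^ (-a) :=
      Real.rpow_le_rpow_of_nonpos hwmem.1 (by linarith) (by linarith)
    exact mul_le_mul h1 h2 (by positivity) (fracHeatKernel_nonneg hα _ _)
  have hnn : ∀ w : SpaceTime n, 0 ≤ fracHeatKernel n α (z.1 - w.1) (z.2 - w.2) *
      (paraboloidPower n ε a w).toReal := fun w =>
    mul_nonneg (fracHeatKernel_nonneg hα _ _) ENNReal.toReal_nonneg
  have h1 := setIntegral_ge_of_const_le_real hBm hBt hpt hint.integrableOn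
  have h2 := setIntegral_mono_set (s := B) (t := {w : SpaceTime n | w.2 < z.2})
    hint.integrableOn (Eventually.of_forall hnn) (LE.le.eventuallyLE hsub)
  refine le_trans (le_of_eq ?_) (h1.trans h2)
  rw [hBv, div_eq_mul_one_div s 4, Real.mul_rpow hz1.le (by norm_num)]
  have h3 : s ^ (α - a) =
      s ^ (α - 1 - (n : ℝ) / 2) * s ^ (-a) * s ^ ((n : ℝ) / 2) * s := by
    nth_rewrite 5 [← Real.rpow_one s]
    rw [← Real.rpow_add hz1, ← Real.rpow_add hz1, ← Real.rpow_add hz1]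
    congr 1; ring
  rw [h3]; ring

/-- If the exponents leave a gap, then on thin paraboloids the power `-b` is dominated by the
`σ`-th power of the potential of the power `-a`. -/
lemma exists_paraboloidPower_le_fracHeatPotential_rpow (n : ℕ) (hα : 0 < α) {a b σ : ℝ}
    (ha : 0 < a) (haM : a < ((n : ℝ) + 2) / 2) (hσ : 0 < σ) (hgap : b < σ * (a - α)) :
    ∃ ε₀ > 0, ∀ ε : ℝ, 0 < ε → ε ≤ ε₀ → ε ≤ 1 → ∀ᵐ z : SpaceTime n,
      (paraboloidPower n ε b z).toReal ≤
        fracHeatPotential n α (fun w => (paraboloidPower n ε a w).toReal) z ^ σ := by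
  obtain ⟨c, hc, h⟩ := exists_fracHeatPotential_lower_bound n hα ha
  set κ := σ * (a - α) - b with hκ
  have hκ0 : 0 < κ := by linarith
  -- Chosen so that elapsed times `s ≤ ε₀` satisfy `s^κ ≤ c^σ`; elapsed times are below `ε` since
  -- apex times are below one.
  refine ⟨(c ^ σ) ^ κ⁻¹, by positivity, fun ε hε hεc hε1 => ?_⟩
  have hint : Integrable fun w : SpaceTime n => (paraboloidPower n ε a w).toReal :=
    memLp_one_iff_integrable.1 (by
      simpa using memLp_paraboloidPower (n := n) hε hε1 (a := a) one_pos (by linarith))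
  filter_upwards [ae_integrable_fracHeatKernel_mul hα hint fun z hz => by
    rw [paraboloidPower_of_nonpos a hz, ENNReal.toReal_zero]] with z hz
  by_cases hm : ∃ j, z ∈ paraboloid n ε j
  · obtain ⟨j, hj⟩ := hm
    have hlb := h ε hε1 j z hj hz
    have hj0 := hj.1
    rw [paraboloidPower_of_mem hε1 b hj, ENNReal.toReal_ofReal (Real.rpow_nonneg hj.1.le _)]
    have hsε : z.2 - apexTime j ≤ (c ^ σ) ^ κ⁻¹ := by
      have := hj.2.1
      nlinarith [apexTime_lt_one j]
    set s := z.2 - apexTime j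
    calc s ^ (-b) = s ^ κ * s ^ ((α - a) * σ) := by
          rw [← Real.rpow_add hj0]; congr 1; rw [hκ]; ring
      _ ≤ c ^ σ * s ^ ((α - a) * σ) := by
          gcongr
          calc s ^ κ ≤ ((c ^ σ) ^ κ⁻¹) ^ κ := by gcongr
            _ = c ^ σ := Real.rpow_inv_rpow (by positivity) hκ0.ne'
      _ = (c * s ^ (α - a)) ^ σ := by
          rw [Real.mul_rpow hc.le (by positivity), ← Real.rpow_mul hj0.le]
      _ ≤ _ := by gcongr
  · push Not at hm
    rw [paraboloidPower_of_notMem b hm, ENNReal.toReal_zero]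
    exact Real.rpow_nonneg (fracHeatPotential_nonneg hα (fun _ => ENNReal.toReal_nonneg) z) _

end

/-! ### Choice of exponents and conclusion. -/

/-- The choice of the two singular exponents. -/
lemma exists_singular_exponents {M p q lam σ α β r s : ℝ} (hM : 0 < M) (hp : 0 < p)
    (hq : 0 < q) (hlam : 0 < lam) (hσ : 0 < σ) (hβ : 0 < β) (hr : p < r)
    (hsub : p * α < M)
    (hord : (M - p * α) * q ^ 2 * σ ≤ (M - q * β) * p ^ 2 * lam)
    (hμ : p * β / (M - p * α) + M / ((M - p * α) * lam) < σ)
    (hsq : q < s) (hs : M * p / ((M - p * α) * σ) < s) :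
    ∃ a b : ℝ, 0 < a ∧ 0 < b ∧ a * p < M ∧ b * q < M ∧ M ≤ a * r ∧ M ≤ b * s ∧
      b < σ * (a - α) ∧ a < lam * (b - β) := by
  have hD : 0 < M - p * α := by linarith
  have hs0 : 0 < s := hq.trans hsq
  have hr0 : 0 < r := hp.trans hr
  have hμ' : p * β * lam + M < σ * ((M - p * α) * lam) := by
    have : p * β / (M - p * α) + M / ((M - p * α) * lam) =
        (p * β * lam + M) / ((M - p * α) * lam) := by field_simp
    rwa [this, div_lt_iff₀ (by positivity)] at hμ
  have hq1 : β + M / (p * lam) < M / q := by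
    have key : q * (p * β * lam + M) < p * lam * M := by
      -- The cases are `σ ≤ σ₀` and `σ > σ₀`: the bound follows from `σ > μ(lam)` in the first and
      -- from `hord` in the second.
      rcases le_or_gt (q * σ * (M - p * α)) (M * p) with h | h
      · nlinarith [mul_lt_mul_of_pos_left hμ' hq]
      · have h1 : q * (M * p) < (M - q * β) * p ^ 2 * lam := by
          nlinarith [mul_lt_mul_of_pos_left h hq]
        have h2 : p * (q * M) < p * ((M - q * β) * p * lam) := by nlinarith
        nlinarith [lt_of_mul_lt_mul_left h2 hp.le]
    have : β + M / (p * lam) = (p * β * lam + M) / (p * lam) := by field_simp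
    rw [this, div_lt_div_iff₀ (by positivity) hq]
    linarith
  have hq2 : β + M / (p * lam) < σ * (M / p - α) := by
    have h1 : β + M / (p * lam) = (p * β * lam + M) / (p * lam) := by field_simp
    have h2 : σ * (M / p - α) = σ * (M - p * α) / p := by field_simp
    rw [h1, h2, div_lt_div_iff₀ (by positivity) hp]
    nlinarith
  have hs1 : M / s < M / q := by gcongr
  have hs2 : M / s < σ * (M / p - α) := by
    rw [div_lt_iff₀ (by positivity)] at hs ⊢
    have h2 : σ * (M / p - α) * s = s * ((M - p * α) * σ) / p := by field_simp
    rw [h2, lt_div_iff₀ hp]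
    exact hs
  -- Take `b` as if `a` were the critical value `M / p`; `a` is then fitted just below it, and `b >
  -- β + M / (p * lam)` still gives `a < lam * (b - β)`.
  obtain ⟨b, hb1, hb2⟩ := exists_between
    (max_lt (lt_min hs1 hs2) (lt_min hq1 hq2))
  obtain ⟨hbs, hbβ⟩ := max_lt_iff.1 hb1
  obtain ⟨hbq, hbσ⟩ := lt_min_iff.1 hb2
  have ha1 : M / r < M / p := by gcongr
  have ha2 : α + b / σ < M / p := by
    have : b / σ < M / p - α := by rw [div_lt_iff₀ hσ]; linarith
    linarith
  obtain ⟨a, haa, hap⟩ := exists_between (max_lt ha1 ha2)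
  obtain ⟨har, haα⟩ := max_lt_iff.1 haa
  refine ⟨a, b, (div_pos hM hr0).trans har, (div_pos hM hs0).trans hbs,
    (lt_div_iff₀ hp).1 hap, (lt_div_iff₀ hq).1 hbq, ((div_lt_iff₀ hr0).1 har).le,
    ((div_lt_iff₀ hs0).1 hbs).le, ?_, ?_⟩
  · have : b / σ < a - α := by linarith
    rw [div_lt_iff₀ hσ] at this
    linarith
  · have : M / p / lam < b - β := by rw [div_div]; linarith
    rw [div_lt_iff₀ hlam] at this
    linarith

theorem theorem2p5 (n : ℕ) (hn : 1 ≤ n)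
    (p q lam σ α β : ℝ) (hp : 1 ≤ p) (hq : 1 ≤ q)
    (hlam : 0 < lam) (hσ : 0 < σ) (hα : 0 < α) (hβ : 0 < β)
    (hpα : FracHeatAdmissible n p α) (hqβ : FracHeatAdmissible n q β)
    (hord : ((n : ℝ) + 2 - 2 * p * α) * q ^ 2 * σ ≤ ((n : ℝ) + 2 - 2 * q * β) * p ^ 2 * lam)
    (hsub : 2 * p * α < (n : ℝ) + 2)
    (hμ : muCurve n p α β lam < σ)
    (r s : ℝ≥0∞) (hr : ENNReal.ofReal p < r)
    (hs : ENNReal.ofReal (max q (q * sigmaZero n p q α / σ)) < s) :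
    ∃ u v f g : SpaceTime n → ℝ, ∃ t : ℕ → ℝ,
      MemY n p α u ∧ MemY n q β v ∧
      -- `f = (∂_t - Δ)^α u` and `g = (∂_t - Δ)^β v`
      IsFracHeat n p α u f ∧ IsFracHeat n q β v g ∧
      (∀ᵐ z : SpaceTime n, 0 ≤ f z ∧ f z ≤ v z ^ lam) ∧
      (∀ᵐ z : SpaceTime n, 0 ≤ g z ∧ g z ≤ u z ^ σ) ∧
      (∀ᵐ z : SpaceTime n, 0 ≤ u z ∧ 0 ≤ v z) ∧
      (∀ᵐ z : SpaceTime n, z.2 < 0 → u z = 0 ∧ v z = 0) ∧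
      (∀ j, t j ∈ Ioo (0 : ℝ) 1) ∧ Tendsto t atTop (𝓝 0) ∧
      ∀ j,
        eLpNorm (fun z => v z ^ lam) r (volume.restrict (parabolicRegion n (t j))) = ∞ ∧
        eLpNorm f r (volume.restrict (parabolicRegion n (t j))) = ∞ ∧
        eLpNorm (fun z => u z ^ σ) s (volume.restrict (parabolicRegion n (t j))) = ∞ ∧
        eLpNorm g s (volume.restrict (parabolicRegion n (t j))) = ∞ := by
  have hp0 : 0 < p := by linarith
  have hq0 : 0 < q := by linarith
  -- `r` and `s` may be infinite, so finite exponents strictly above the thresholds replace them.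
  obtain ⟨r', hr'0, hpr', hr'r⟩ := ENNReal.lt_iff_exists_real_btwn.1 hr
  obtain ⟨s', hs'0, hqs', hs's⟩ := ENNReal.lt_iff_exists_real_btwn.1 hs
  have hpr := lt_of_not_ge fun h => hpr'.not_ge (ENNReal.ofReal_le_ofReal h)
  have hqs := lt_of_not_ge fun h => hqs'.not_ge (ENNReal.ofReal_le_ofReal h)
  obtain ⟨hqs1, hqs2⟩ := max_lt_iff.1 hqs
  have hD : 0 < (n : ℝ) + 2 - 2 * p * α := by linarith
  have hD2 : ((n : ℝ) + 2) / 2 - p * α = ((n : ℝ) + 2 - 2 * p * α) / 2 := by ring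
  obtain ⟨a, b, ha, hb, hap, hbq, har, hbs, hba, hab⟩ :=
    exists_singular_exponents (M := ((n : ℝ) + 2) / 2) (α := α) (r := r') (s := s') (by positivity)
      hp0 hq0 hlam hσ hβ hpr (by linarith) (by linarith)
      (by
        refine lt_of_eq_of_lt ?_ hμ
        rw [muCurve, hD2]
        field_simp) hqs1
      (by
        refine lt_of_eq_of_lt ?_ hqs2
        rw [sigmaZero, hD2]
        field_simp)
  -- As `p, q ≥ 1`, both densities are also in `L¹`, which makes the potentials converge almost
  -- everywhere.
  have haM : a < ((n : ℝ) + 2) / 2 := by nlinarith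
  have hbM : b < ((n : ℝ) + 2) / 2 := by nlinarith
  obtain ⟨ε₁, hε₁, h1⟩ :=
    exists_paraboloidPower_le_fracHeatPotential_rpow n hα ha haM hσ hba
  obtain ⟨ε₂, hε₂, h2⟩ :=
    exists_paraboloidPower_le_fracHeatPotential_rpow n hβ hb hbM hlam hab
  set ε := min 1 (min ε₁ ε₂) with hεdef
  have hε : 0 < ε := by positivity
  have hε1 : ε ≤ 1 := min_le_left _ _
  have hg := h1 ε hε ((min_le_right _ _).trans (min_le_left _ _)) hε1
  have hf := h2 ε hε ((min_le_right _ _).trans (min_le_right _ _)) hε1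
  set f : SpaceTime n → ℝ := fun z => (paraboloidPower n ε a z).toReal with hfdef
  set g : SpaceTime n → ℝ := fun z => (paraboloidPower n ε b z).toReal with hgdef
  have hf0 : ∀ z, 0 ≤ f z := fun _ => ENNReal.toReal_nonneg
  have hg0 : ∀ z, 0 ≤ g z := fun _ => ENNReal.toReal_nonneg
  have hfz : ∀ z : SpaceTime n, z.2 ≤ 0 → f z = 0 := fun z hz => by
    simp [hfdef, paraboloidPower_of_nonpos a hz]
  have hgz : ∀ z : SpaceTime n, z.2 ≤ 0 → g z = 0 := fun z hz => by
    simp [hgdef, paraboloidPower_of_nonpos b hz]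
  have hfX : MemX n p f := fun T => (memLp_paraboloidPower hε hε1 hp0 hap).restrict _
  have hgX : MemX n q g := fun T => (memLp_paraboloidPower hε hε1 hq0 hbq).restrict _
  have hfi : Integrable f := memLp_one_iff_integrable.1 (by
    simpa using memLp_paraboloidPower (n := n) hε hε1 (a := a) one_pos (by linarith))
  have hgi : Integrable g := memLp_one_iff_integrable.1 (by
    simpa using memLp_paraboloidPower (n := n) hε hε1 (a := b) one_pos (by linarith))
  have hfP := eqPotential_fracHeatPotential hα hfi hfz
  have hgP := eqPotential_fracHeatPotential hβ hgi hgz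
  have hfr := eLpNorm_paraboloidPower_eq_top (n := n) hε hε1 (hp0.trans hpr) har hr'r.le
  have hgs := eLpNorm_paraboloidPower_eq_top (n := n) hε hε1 (hq0.trans hqs1) hbs hs's.le
  refine ⟨fracHeatPotential n α f, fracHeatPotential n β g, f, g, apexTime, ⟨f, hfX, hfP⟩,
    ⟨g, hgX, hgP⟩, ⟨hfX, hfP⟩, ⟨hgX, hgP⟩, ?_, ?_, ?_, ?_,
    fun j => ⟨apexTime_pos j, apexTime_lt_one j⟩, tendsto_apexTime,
    fun j => ⟨?_, hfr j, ?_, hgs j⟩⟩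
  · filter_upwards [hf] with z hz using ⟨hf0 z, hz⟩
  · filter_upwards [hg] with z hz using ⟨hg0 z, hz⟩
  · exact Eventually.of_forall fun z =>
      ⟨fracHeatPotential_nonneg hα hf0 z, fracHeatPotential_nonneg hβ hg0 z⟩
  · exact Eventually.of_forall fun z hz =>
      ⟨fracHeatPotential_of_nonpos hfz hz.le, fracHeatPotential_of_nonpos hgz hz.le⟩
  · refine top_unique ((hfr j).symm.le.trans (eLpNorm_mono_ae_real ?_))
    filter_upwards [ae_restrict_of_ae hf] with z hz
    rwa [Real.norm_of_nonneg (hf0 z)]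
  · refine top_unique ((hgs j).symm.le.trans (eLpNorm_mono_ae_real ?_))
    filter_upwards [ae_restrict_of_ae hg] with z hz
    rwa [Real.norm_of_nonneg (hg0 z)]
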